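/- Let $d_1,d_2,d_3\ge 2$, and equip $\mathbb{R}^{d_1\times d_2\times d_3}$ with the Frobenius norm $\|A\|_F=\bigl(\sum_{i,j,k}a_{ijk}^2\bigr)^{1/2}$ and Lebesgue measure. For $x\in\mathbb{R}^{d_1}$, $y\in\mathbb{R}^{d_2}$, $z\in\mathbb{R}^{d_3}$ let $x\otimes y\otimes z$ be the tensor with entries $x_iy_jz_k$, and let $\operatorname{rank}_\otimes(A)$ be the least number $r$ such that $A$ is a sum of $r$ tensors of this form. A best rank-$2$ approximation of $A$ is a tensor $B$ with $\operatorname{rank}_\otimes(B)\le 2$ and $\|A-B\|_F\le\|A-C\|_F$ for every tensor $C\in\mathbb{R}^{d_1\times d_2\times d_3}$ with $\operatorname{rank}_\otimes(C)\le 2$. Let $\mathcal{N}$ be the set of tensors in $\mathbb{R}^{d_1\times d_2\times d_3}$ that have no best rank-$2$ approximation. Let $G_3\in\mathbb{R}^{2\times2\times2}$ be the tensor $$G_3=\left[\begin{array}{rr}1&0\\0&1\end{array}\right|\left.\begin{array}{rr}0&-1\\1&0\end{array}\right],$$ where the two blocks are the slabs $(g_{1jk})_{j,k}$ and $(g_{2jk})_{j,k}$,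 and let $G_3\oplus 0\in\mathbb{R}^{d_1\times d_2\times d_3}$ be its extension by zero. A tensor $A=(a_{ijk})\in\mathbb{R}^{d_1\times d_2\times d_3}$ is of type $G_3$ if there are $L\in\mathrm{GL}_{d_1}(\mathbb{R})$, $M\in\mathrm{GL}_{d_2}(\mathbb{R})$, $N\in\mathrm{GL}_{d_3}(\mathbb{R})$ with $$(G_3\oplus 0)_{pqr}=\sum_{i,j,k}L_{pi}M_{qj}N_{rk}\,a_{ijk}\quad\text{for all }p,q,r.$$ Theorem. There is a nonempty open set $U\subseteq\mathbb{R}^{d_1\times d_2\times d_3}$ that contains every tensor of type $G_3$ and satisfies $U\subseteq\mathcal{N}$. In particular, $\mathcal{N}$ is nonempty and has positive Lebesgue measure. -/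

import Mathlib

/-- The space `ℝ^{d₁ × d₂ × d₃}` of real three-way arrays. As a Euclidean space it carries the
Frobenius norm, and `volume` on it is Lebesgue measure. -/
abbrev Tensor3 (d₁ d₂ d₃ : ℕ) : Type :=
  EuclideanSpace ℝ (Fin d₁ × Fin d₂ × Fin d₃)

namespace Tensor3

/-- The norm of `Tensor3` is the Frobenius norm. -/
theorem norm_sq_eq_sum {d₁ d₂ d₃ : ℕ} (A : Tensor3 d₁ d₂ d₃) :
    ‖A‖ ^ 2 = ∑ i, ∑ j, ∑ k, |A (i, j, k)| ^ 2 := by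
  rw [EuclideanSpace.norm_sq_eq, Fintype.sum_prod_type]
  simp only [Fintype.sum_prod_type, Real.norm_eq_abs]

/-- The outer product `x ⊗ y ⊗ z`, that is, the array with entries `x i * y j * z k`. -/
noncomputable def outer {d₁ d₂ d₃ : ℕ} (x : Fin d₁ → ℝ) (y : Fin d₂ → ℝ) (z : Fin d₃ → ℝ) :
    Tensor3 d₁ d₂ d₃ :=
  WithLp.toLp 2 fun p => x p.1 * y p.2.1 * z p.2.2

/-- `A` is a sum of `r` decomposable tensors. -/
def IsSumOfOuter {d₁ d₂ d₃ : ℕ} (A : Tensor3 d₁ d₂ d₃) (r : ℕ) : Prop :=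
  ∃ (x : Fin r → Fin d₁ → ℝ) (y : Fin r → Fin d₂ → ℝ) (z : Fin r → Fin d₃ → ℝ),
    A = ∑ s, outer (x s) (y s) (z s)

/-- The outer-product rank: the least number of decomposable tensors with sum `A`. -/
noncomputable def rank {d₁ d₂ d₃ : ℕ} (A : Tensor3 d₁ d₂ d₃) : ℕ :=
  sInf {r : ℕ | IsSumOfOuter A r}

/-- Every tensor is a finite sum of decomposable tensors, so the minimum defining the rank is taken
over a nonempty set. -/
theorem exists_isSumOfOuter {d₁ d₂ d₃ : ℕ} (A : Tensor3 d₁ d₂ d₃) : ∃ r, IsSumOfOuter A r := by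
  let e := Fintype.equivFin (Fin d₁ × Fin d₂ × Fin d₃)
  refine ⟨Fintype.card (Fin d₁ × Fin d₂ × Fin d₃),
    fun s => Pi.single (e.symm s).1 (A (e.symm s)), fun s => Pi.single (e.symm s).2.1 1,
    fun s => Pi.single (e.symm s).2.2 1, ?_⟩
  rw [Equiv.sum_comp e.symm (fun p => outer (Pi.single p.1 (A p)) (Pi.single p.2.1 1)
    (Pi.single p.2.2 1))]
  ext ⟨i, j, k⟩
  simp [outer, Fintype.sum_prod_type, Pi.single_apply]

/-- `B` is a best rank-`r` approximation of `A` in the Frobenius norm: `B` minimizes `‖A - B‖`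
among the tensors of rank at most `r`. -/
def IsBestApprox {d₁ d₂ d₃ : ℕ} (A : Tensor3 d₁ d₂ d₃) (r : ℕ) (B : Tensor3 d₁ d₂ d₃) : Prop :=
  rank B ≤ r ∧ ∀ C : Tensor3 d₁ d₂ d₃, rank C ≤ r → ‖A - B‖ ≤ ‖A - C‖

/-- The tensors that have no best rank-`r` approximation in the Frobenius norm. -/
def noBestApprox (d₁ d₂ d₃ r : ℕ) : Set (Tensor3 d₁ d₂ d₃) :=
  {A | ¬ ∃ B, IsBestApprox A r B}

/-- Multilinear multiplication `(L, M, N) · A`. -/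
noncomputable def mulAct {c₁ c₂ c₃ d₁ d₂ d₃ : ℕ} (L : Matrix (Fin c₁) (Fin d₁) ℝ)
    (M : Matrix (Fin c₂) (Fin d₂) ℝ) (N : Matrix (Fin c₃) (Fin d₃) ℝ) (A : Tensor3 d₁ d₂ d₃) :
    Tensor3 c₁ c₂ c₃ :=
  WithLp.toLp 2 fun p => ∑ i, ∑ j, ∑ k, L p.1 i * M p.2.1 j * N p.2.2 k * A (i, j, k)

/-- The image `B ⊕ 0` of `B` under the canonical embedding
`ℝ^{c₁ × c₂ × c₃} ⊂ ℝ^{d₁ × d₂ × d₃}` (for `cᵢ ≤ dᵢ`): extension by zero from the leading block. -/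
noncomputable def extend {c₁ c₂ c₃ : ℕ} (d₁ d₂ d₃ : ℕ) (B : Tensor3 c₁ c₂ c₃) :
    Tensor3 d₁ d₂ d₃ :=
  WithLp.toLp 2 fun p =>
    if h : (p.1 : ℕ) < c₁ ∧ (p.2.1 : ℕ) < c₂ ∧ (p.2.2 : ℕ) < c₃ then
      B (⟨p.1, h.1⟩, ⟨p.2.1, h.2.1⟩, ⟨p.2.2, h.2.2⟩)
    else 0

/-- The tensor `G₃ = [1 0; 0 1 | 0 -1; 1 0]` of `ℝ^{2 × 2 × 2}`; the two slabs are the matrices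
`G₃ (0, ·, ·)` and `G₃ (1, ·, ·)`. -/
noncomputable def G₃ : Tensor3 2 2 2 :=
  WithLp.toLp 2 fun p =>
    (![!![1, 0; 0, 1], !![0, -1; 1, 0]] : Fin 2 → Matrix (Fin 2) (Fin 2) ℝ) p.1 p.2.1 p.2.2

/-- `A` has type `G₃`: it is `GL`-equivalent to `G₃ ⊕ 0`. -/
def IsTypeG₃ {d₁ d₂ d₃ : ℕ} (A : Tensor3 d₁ d₂ d₃) : Prop :=
  ∃ (L : GL (Fin d₁) ℝ) (M : GL (Fin d₂) ℝ) (N : GL (Fin d₃) ℝ),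
    extend d₁ d₂ d₃ G₃ =
      mulAct (L : Matrix (Fin d₁) (Fin d₁) ℝ) (M : Matrix (Fin d₂) (Fin d₂) ℝ)
        (N : Matrix (Fin d₃) (Fin d₃) ℝ) A

end Tensor3

/-! The `2 × 2 × 2` case rests on two facts. If `b` is a best rank-two approximation of `a`, the
residual `a - b` is orthogonal to every line through `b` inside the rank-two set, and the directions
of such lines span the whole space; hence `a = b` (`eq_of_isBestApprox_two`). The hyperdeterminant
is nonnegative on rank at most two and negative at `G₃`.

In general, write `A₀` of type `G₃` as a core of negative hyperdeterminant placed in three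
orthonormal frames, and suppose that tensors `A` with best approximations `B` converge to `A₀`. Each
`B` lies in three frames, and the compression of `A` to them has rank at most two
(`isSumOfOuter_compression`), so its hyperdeterminant is nonnegative. By compactness the frames and
the `B` converge. The limit `B₁` lies both in the limiting frames and in those of `A₀`, where its
core `b` has rank above two. A core of rank above two is degenerate in no mode, so the two triples
of frames are related by invertible `2 × 2` matrices. The limiting compression of `A₀` then has
negative hyperdeterminant, a contradiction. -/

open Filter Topology Matrix

namespace Tensor3

/-! ### Multilinear multiplication and rank -/

section MulAct

variable {b₁ b₂ b₃ c₁ c₂ c₃ d₁ d₂ d₃ : ℕ}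

@[simp] theorem outer_apply (x : Fin d₁ → ℝ) (y : Fin d₂ → ℝ) (z : Fin d₃ → ℝ) (i : Fin d₁)
    (j : Fin d₂) (k : Fin d₃) : outer x y z (i, j, k) = x i * y j * z k := rfl

theorem mulAct_apply (L : Matrix (Fin c₁) (Fin d₁) ℝ) (M : Matrix (Fin c₂) (Fin d₂) ℝ)
    (N : Matrix (Fin c₃) (Fin d₃) ℝ) (A : Tensor3 d₁ d₂ d₃) (p : Fin c₁) (q : Fin c₂)
    (r : Fin c₃) :
    mulAct L M N A (p, q, r) = ∑ i, ∑ j, ∑ k, L p i * M q j * N r k * A (i, j, k) := rfl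

theorem mulAct_add (L : Matrix (Fin c₁) (Fin d₁) ℝ) (M : Matrix (Fin c₂) (Fin d₂) ℝ)
    (N : Matrix (Fin c₃) (Fin d₃) ℝ) (A B : Tensor3 d₁ d₂ d₃) :
    mulAct L M N (A + B) = mulAct L M N A + mulAct L M N B := by
  ext ⟨p, q, r⟩
  simp [mulAct_apply, mul_add, Finset.sum_add_distrib]

theorem mulAct_smul (L : Matrix (Fin c₁) (Fin d₁) ℝ) (M : Matrix (Fin c₂) (Fin d₂) ℝ)
    (N : Matrix (Fin c₃) (Fin d₃) ℝ) (t : ℝ) (A : Tensor3 d₁ d₂ d₃) :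
    mulAct L M N (t • A) = t • mulAct L M N A := by
  ext ⟨p, q, r⟩
  simp [mulAct_apply, Finset.mul_sum, mul_left_comm]

/-- Multilinear multiplication as a linear map. -/
noncomputable def mulActₗ (L : Matrix (Fin c₁) (Fin d₁) ℝ) (M : Matrix (Fin c₂) (Fin d₂) ℝ)
    (N : Matrix (Fin c₃) (Fin d₃) ℝ) : Tensor3 d₁ d₂ d₃ →ₗ[ℝ] Tensor3 c₁ c₂ c₃ where
  toFun := mulAct L M N
  map_add' := mulAct_add L M N
  map_smul' := mulAct_smul L M N

@[simp] theorem mulActₗ_apply (L : Matrix (Fin c₁) (Fin d₁) ℝ) (M : Matrix (Fin c₂) (Fin d₂) ℝ)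
    (N : Matrix (Fin c₃) (Fin d₃) ℝ) (A : Tensor3 d₁ d₂ d₃) :
    mulActₗ L M N A = mulAct L M N A := rfl

theorem mulAct_sub_left (L L' : Matrix (Fin c₁) (Fin d₁) ℝ) (M : Matrix (Fin c₂) (Fin d₂) ℝ)
    (N : Matrix (Fin c₃) (Fin d₃) ℝ) (A : Tensor3 d₁ d₂ d₃) :
    mulAct (L - L') M N A = mulAct L M N A - mulAct L' M N A := by
  ext ⟨p, q, r⟩
  simp [mulAct_apply, sub_mul, Finset.sum_sub_distrib]

theorem mulAct_sub_middle (L : Matrix (Fin c₁) (Fin d₁) ℝ) (M M' : Matrix (Fin c₂) (Fin d₂) ℝ)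
    (N : Matrix (Fin c₃) (Fin d₃) ℝ) (A : Tensor3 d₁ d₂ d₃) :
    mulAct L (M - M') N A = mulAct L M N A - mulAct L M' N A := by
  ext ⟨p, q, r⟩
  simp [mulAct_apply, sub_mul, mul_sub, Finset.sum_sub_distrib]

theorem mulAct_sub_right (L : Matrix (Fin c₁) (Fin d₁) ℝ) (M : Matrix (Fin c₂) (Fin d₂) ℝ)
    (N N' : Matrix (Fin c₃) (Fin d₃) ℝ) (A : Tensor3 d₁ d₂ d₃) :
    mulAct L M (N - N') A = mulAct L M N A - mulAct L M N' A := by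
  ext ⟨p, q, r⟩
  simp [mulAct_apply, sub_mul, mul_sub, Finset.sum_sub_distrib]

theorem mulAct_one (A : Tensor3 d₁ d₂ d₃) : mulAct 1 1 1 A = A := by
  ext ⟨p, q, r⟩
  simp [mulAct_apply, Matrix.one_apply]

theorem mulAct_outer (L : Matrix (Fin c₁) (Fin d₁) ℝ) (M : Matrix (Fin c₂) (Fin d₂) ℝ)
    (N : Matrix (Fin c₃) (Fin d₃) ℝ) (x : Fin d₁ → ℝ) (y : Fin d₂ → ℝ) (z : Fin d₃ → ℝ) :
    mulAct L M N (outer x y z) = outer (L *ᵥ x) (M *ᵥ y) (N *ᵥ z) := by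
  ext ⟨p, q, r⟩
  simp only [mulAct_apply, outer_apply, Matrix.mulVec, dotProduct]
  rw [Finset.sum_mul_sum, Finset.sum_mul]
  refine Finset.sum_congr rfl fun i _ => ?_
  rw [Finset.sum_mul]
  refine Finset.sum_congr rfl fun j _ => ?_
  rw [Finset.mul_sum]
  exact Finset.sum_congr rfl fun k _ => by ring

theorem mulAct_mulAct (L : Matrix (Fin b₁) (Fin c₁) ℝ) (M : Matrix (Fin b₂) (Fin c₂) ℝ)
    (N : Matrix (Fin b₃) (Fin c₃) ℝ) (L' : Matrix (Fin c₁) (Fin d₁) ℝ)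
    (M' : Matrix (Fin c₂) (Fin d₂) ℝ) (N' : Matrix (Fin c₃) (Fin d₃) ℝ) (A : Tensor3 d₁ d₂ d₃) :
    mulAct L M N (mulAct L' M' N' A) = mulAct (L * L') (M * M') (N * N') A := by
  -- Both sides are linear in `A`, so decomposable tensors suffice.
  obtain ⟨r, x, y, z, rfl⟩ := exists_isSumOfOuter A
  simp only [← mulActₗ_apply, map_sum]
  simp only [mulActₗ_apply, mulAct_outer, Matrix.mulVec_mulVec]

theorem inner_mulAct (L : Matrix (Fin c₁) (Fin d₁) ℝ) (M : Matrix (Fin c₂) (Fin d₂) ℝ)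
    (N : Matrix (Fin c₃) (Fin d₃) ℝ) (A : Tensor3 d₁ d₂ d₃) (B : Tensor3 c₁ c₂ c₃) :
    inner ℝ (mulAct L M N A) B = inner ℝ A (mulAct Lᵀ Mᵀ Nᵀ B) := by
  simp only [PiLp.inner_apply, RCLike.inner_apply, conj_trivial]
  have h1 : ∀ p : Fin c₁ × Fin c₂ × Fin c₃, mulAct L M N A p =
      ∑ i : Fin d₁ × Fin d₂ × Fin d₃, L p.1 i.1 * M p.2.1 i.2.1 * N p.2.2 i.2.2 * A i := by
    intro p; simp [Fintype.sum_prod_type, mulAct]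
  have h2 : ∀ p : Fin d₁ × Fin d₂ × Fin d₃, mulAct Lᵀ Mᵀ Nᵀ B p =
      ∑ i : Fin c₁ × Fin c₂ × Fin c₃, L i.1 p.1 * M i.2.1 p.2.1 * N i.2.2 p.2.2 * B i := by
    intro p; simp [Fintype.sum_prod_type, mulAct]
  simp only [h1, h2, Finset.mul_sum, Finset.sum_mul]
  rw [Finset.sum_comm]
  refine Finset.sum_congr rfl fun i _ => Finset.sum_congr rfl fun j _ => by ring

theorem continuous_mulAct :
    Continuous fun p : Matrix (Fin c₁) (Fin d₁) ℝ × Matrix (Fin c₂) (Fin d₂) ℝ ×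
      Matrix (Fin c₃) (Fin d₃) ℝ × Tensor3 d₁ d₂ d₃ => mulAct p.1 p.2.1 p.2.2.1 p.2.2.2 := by
  unfold mulAct
  refine (PiLp.continuous_toLp 2 _).comp (continuous_pi fun q => ?_)
  refine continuous_finsetSum _ fun i _ => continuous_finsetSum _ fun j _ =>
    continuous_finsetSum _ fun k _ => ?_
  have h1 : Continuous fun p : Matrix (Fin c₁) (Fin d₁) ℝ × Matrix (Fin c₂) (Fin d₂) ℝ ×
      Matrix (Fin c₃) (Fin d₃) ℝ × Tensor3 d₁ d₂ d₃ => p.1 q.1 i :=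
    continuous_fst.matrix_elem _ _
  have h2 : Continuous fun p : Matrix (Fin c₁) (Fin d₁) ℝ × Matrix (Fin c₂) (Fin d₂) ℝ ×
      Matrix (Fin c₃) (Fin d₃) ℝ × Tensor3 d₁ d₂ d₃ => p.2.1 q.2.1 j :=
    (continuous_fst.comp continuous_snd).matrix_elem _ _
  have h3 : Continuous fun p : Matrix (Fin c₁) (Fin d₁) ℝ × Matrix (Fin c₂) (Fin d₂) ℝ ×
      Matrix (Fin c₃) (Fin d₃) ℝ × Tensor3 d₁ d₂ d₃ => p.2.2.1 q.2.2 k :=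
    (continuous_fst.comp (continuous_snd.comp continuous_snd)).matrix_elem _ _
  fun_prop

theorem tendsto_mulAct {α : Type*} {l : Filter α} {L : α → Matrix (Fin c₁) (Fin d₁) ℝ}
    {M : α → Matrix (Fin c₂) (Fin d₂) ℝ} {N : α → Matrix (Fin c₃) (Fin d₃) ℝ}
    {A : α → Tensor3 d₁ d₂ d₃} {L₀ : Matrix (Fin c₁) (Fin d₁) ℝ} {M₀ : Matrix (Fin c₂) (Fin d₂) ℝ}
    {N₀ : Matrix (Fin c₃) (Fin d₃) ℝ} {A₀ : Tensor3 d₁ d₂ d₃} (hL : Tendsto L l (𝓝 L₀))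
    (hM : Tendsto M l (𝓝 M₀)) (hN : Tendsto N l (𝓝 N₀)) (hA : Tendsto A l (𝓝 A₀)) :
    Tendsto (fun a => mulAct (L a) (M a) (N a) (A a)) l (𝓝 (mulAct L₀ M₀ N₀ A₀)) :=
  Tendsto.comp (f := fun a => (L a, M a, N a, A a))
    (continuous_mulAct.tendsto (L₀, M₀, N₀, A₀))
    (hL.prodMk_nhds (hM.prodMk_nhds (hN.prodMk_nhds hA)))

theorem IsSumOfOuter.map {A : Tensor3 d₁ d₂ d₃} {r : ℕ} (h : IsSumOfOuter A r)
    (L : Matrix (Fin c₁) (Fin d₁) ℝ) (M : Matrix (Fin c₂) (Fin d₂) ℝ)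
    (N : Matrix (Fin c₃) (Fin d₃) ℝ) : IsSumOfOuter (mulAct L M N A) r := by
  obtain ⟨x, y, z, rfl⟩ := h
  refine ⟨fun s => L *ᵥ x s, fun s => M *ᵥ y s, fun s => N *ᵥ z s, ?_⟩
  rw [← mulActₗ_apply, map_sum]
  exact Finset.sum_congr rfl fun s _ => mulAct_outer L M N (x s) (y s) (z s)

theorem IsSumOfOuter.succ {A : Tensor3 d₁ d₂ d₃} {r : ℕ} (h : IsSumOfOuter A r) :
    IsSumOfOuter A (r + 1) := by
  obtain ⟨x, y, z, rfl⟩ := h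
  refine ⟨Fin.cons 0 x, Fin.cons 0 y, Fin.cons 0 z, ?_⟩
  rw [Fin.sum_univ_succ]
  ext ⟨i, j, k⟩
  simp

theorem rank_le_iff {A : Tensor3 d₁ d₂ d₃} {r : ℕ} : rank A ≤ r ↔ IsSumOfOuter A r := by
  refine ⟨fun h => ?_, fun h => Nat.sInf_le h⟩
  exact Nat.le_induction (P := fun r _ => IsSumOfOuter A r)
    (Nat.sInf_mem (exists_isSumOfOuter A)) (fun _ _ h => h.succ) r h

theorem isSumOfOuter_two_iff {A : Tensor3 d₁ d₂ d₃} :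
    IsSumOfOuter A 2 ↔ ∃ x y z x' y' z', A = outer x y z + outer x' y' z' := by
  constructor
  · rintro ⟨x, y, z, h⟩
    exact ⟨_, _, _, _, _, _, by rw [h, Fin.sum_univ_two]⟩
  · rintro ⟨x, y, z, x', y', z', rfl⟩
    exact ⟨![x, x'], ![y, y'], ![z, z'], by simp [Fin.sum_univ_two]⟩

end MulAct

/-- Pythagoras: `f` is an isometry with adjoint `g`, so `f ∘ g` is the orthogonal projection onto
the range of `f`. -/
theorem norm_sub_sq_of_section {E F : Type*} [NormedAddCommGroup E] [InnerProductSpace ℝ E]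
    [NormedAddCommGroup F] [InnerProductSpace ℝ F] (f : E →ₗ[ℝ] F) (g : F →ₗ[ℝ] E)
    (hfg : ∀ x y, inner ℝ (f x) y = inner ℝ x (g y)) (hgf : ∀ x, g (f x) = x) (a : E) (b : F) :
    ‖b - f a‖ ^ 2 = ‖g b - a‖ ^ 2 + ‖b - f (g b)‖ ^ 2 := by
  have h : b - f a = f (g b - a) + (b - f (g b)) := by rw [map_sub]; abel
  have h0 : inner ℝ (f (g b - a)) (b - f (g b)) = 0 := by
    rw [hfg, map_sub, hgf, sub_self, inner_zero_right]
  have h1 : ‖f (g b - a)‖ ^ 2 = ‖g b - a‖ ^ 2 := by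
    rw [← real_inner_self_eq_norm_sq, hfg, hgf, real_inner_self_eq_norm_sq]
  rw [h, norm_add_sq_real, h0, h1]; ring

/-! ### Lines in the rank-two set of `2 × 2 × 2` arrays -/

/-- `b` is a sum of two decomposable `2 × 2 × 2` arrays. -/
def TwoTerm (b : Fin 2 → Fin 2 → Fin 2 → ℝ) : Prop :=
  ∃ x y z x' y' z' : Fin 2 → ℝ, ∀ i j k, b i j k = x i * y j * z k + x' i * y' j * z' k

/-- `r` is orthogonal to every direction along which the line through `b` consists of sums of two
decomposable arrays. -/
def OrthToLines (b r : Fin 2 → Fin 2 → Fin 2 → ℝ) : Prop :=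
  ∀ E : Fin 2 → Fin 2 → Fin 2 → ℝ, (∀ t : ℝ, TwoTerm fun i j k => b i j k + t * E i j k) →
    ∑ i, ∑ j, ∑ k, r i j k * E i j k = 0

theorem isSumOfOuter_two_iff_twoTerm {a : Tensor3 2 2 2} :
    IsSumOfOuter a 2 ↔ TwoTerm fun i j k => a (i, j, k) := by
  rw [isSumOfOuter_two_iff]
  constructor
  · rintro ⟨x, y, z, x', y', z', rfl⟩
    exact ⟨x, y, z, x', y', z', fun i j k => rfl⟩
  · rintro ⟨x, y, z, x', y', z', h⟩
    exact ⟨x, y, z, x', y', z', by ext ⟨i, j, k⟩; exact h i j k⟩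

theorem TwoTerm.rotate {b : Fin 2 → Fin 2 → Fin 2 → ℝ} (h : TwoTerm b) :
    TwoTerm fun i j k => b k i j := by
  obtain ⟨x, y, z, x', y', z', h⟩ := h
  exact ⟨y, z, x, y', z', x', fun i j k => by simp only [h]; ring⟩

theorem OrthToLines.rotate {b r : Fin 2 → Fin 2 → Fin 2 → ℝ} (h : OrthToLines b r) :
    OrthToLines (fun i j k => b k i j) fun i j k => r k i j := by
  intro E hE
  have := h (fun i j k => E j k i) fun t => (hE t).rotate.rotate
  simp only [Fin.sum_univ_two] at this ⊢
  linarith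

theorem twoTerm_matrix_mul (m : Fin 2 → Fin 2 → ℝ) (z : Fin 2 → ℝ) :
    TwoTerm fun i j k => m i j * z k := by
  refine ⟨![1, 0], m 0, z, ![0, 1], m 1, z, fun i j k => ?_⟩
  fin_cases i <;> simp

theorem exists_eq_mul_of_det_eq_zero (n : Fin 2 → Fin 2 → ℝ) (h : n 0 0 * n 1 1 = n 0 1 * n 1 0) :
    ∃ p q : Fin 2 → ℝ, ∀ i j, n i j = p i * q j := by
  by_cases h0 : n 0 0 = 0
  · rw [h0, zero_mul, eq_comm, mul_eq_zero] at h
    rcases h with h | h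
    · exact ⟨![0, 1], n 1, fun i j => by fin_cases i <;> fin_cases j <;> simp [h0, h]⟩
    · exact ⟨fun i => n i 1, ![0, 1], fun i j => by fin_cases i <;> fin_cases j <;> simp [h0, h]⟩
  · refine ⟨fun i => n i 0, fun j => n 0 j / n 0 0, fun i j => ?_⟩
    field_simp
    fin_cases i <;> fin_cases j <;> simp <;> linarith

theorem exists_common_multiple_of_det_eq_zero (z z' : Fin 2 → ℝ) (h : z 0 * z' 1 = z 1 * z' 0) :
    ∃ (w : Fin 2 → ℝ) (α β : ℝ), (w 0 ≠ 0 ∨ w 1 ≠ 0) ∧ (∀ k, z k = α * w k) ∧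
      ∀ k, z' k = β * w k := by
  obtain ⟨p, q, hpq⟩ := exists_eq_mul_of_det_eq_zero ![z, z'] (by simpa using h)
  have h0 : ∀ k, z k = p 0 * q k := fun k => hpq 0 k
  have h1 : ∀ k, z' k = p 1 * q k := fun k => hpq 1 k
  by_cases hq : q 0 ≠ 0 ∨ q 1 ≠ 0
  · exact ⟨q, _, _, hq, h0, h1⟩
  · push Not at hq
    have hq' : ∀ k, q k = 0 := by intro k; fin_cases k; exacts [hq.1, hq.2]
    exact ⟨![1, 0], 0, 0, by simp, fun k => by simp [h0, hq'], fun k => by simp [h1, hq']⟩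

/-- The admissible `x ⊗ y` span all matrices. The determinant of `m - s • (x ⊗ y)` is affine in `s`,
with slope bilinear in `x` and `y`. If `m` is singular, `s = 0` always works; otherwise a nonzero
slope suffices, and for suitable `y` the vectors `x` with nonzero slope span the plane. -/
theorem eq_zero_of_forall_subtract_singular (m ρ : Fin 2 → Fin 2 → ℝ)
    (h : ∀ x y : Fin 2 → ℝ, (∃ (s : ℝ) (p q : Fin 2 → ℝ), ∀ i j, m i j = s * (x i * y j) + p i * q j)
      → ∑ i, ∑ j, ρ i j * (x i * y j) = 0) : ∀ i j, ρ i j = 0 := by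
  have key : ∀ (x y : Fin 2 → ℝ) (s : ℝ), m 0 0 * m 1 1 - m 0 1 * m 1 0 =
      s * (x 0 * y 0 * m 1 1 + x 1 * y 1 * m 0 0 - x 0 * y 1 * m 1 0 - x 1 * y 0 * m 0 1) →
      ∑ i, ∑ j, ρ i j * (x i * y j) = 0 := by
    intro x y s hs
    obtain ⟨p, q, hpq⟩ := exists_eq_mul_of_det_eq_zero (fun i j => m i j - s * (x i * y j))
      (by linear_combination hs)
    exact h x y ⟨s, p, q, fun i j => by rw [← hpq]; ring⟩
  have fin2 : ∀ {P : Fin 2 → Fin 2 → Prop}, P 0 0 → P 0 1 → P 1 0 → P 1 1 → ∀ i j, P i j := by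
    intro P h1 h2 h3 h4 i j
    fin_cases i <;> fin_cases j <;> assumption
  by_cases hm : m 0 0 * m 1 1 - m 0 1 * m 1 0 = 0
  · have h0 := fun x y => key x y 0 (by rw [hm, zero_mul])
    refine fin2 ?_ ?_ ?_ ?_
    · simpa using h0 ![1, 0] ![1, 0]
    · simpa using h0 ![1, 0] ![0, 1]
    · simpa using h0 ![0, 1] ![1, 0]
    · simpa using h0 ![0, 1] ![0, 1]
  · have h1 : ∀ x y : Fin 2 → ℝ, x 0 * y 0 * m 1 1 + x 1 * y 1 * m 0 0 - x 0 * y 1 * m 1 0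
        - x 1 * y 0 * m 0 1 ≠ 0 → ∑ i, ∑ j, ρ i j * (x i * y j) = 0 := fun x y hxy =>
      key x y _ (div_mul_cancel₀ _ hxy).symm
    have h2 : ∀ x₀ x y : Fin 2 → ℝ, x₀ 0 * y 0 * m 1 1 + x₀ 1 * y 1 * m 0 0 - x₀ 0 * y 1 * m 1 0
        - x₀ 1 * y 0 * m 0 1 ≠ 0 → ∑ i, ∑ j, ρ i j * (x i * y j) = 0 := by
      intro x₀ x y h0
      by_cases hx : x 0 * y 0 * m 1 1 + x 1 * y 1 * m 0 0 - x 0 * y 1 * m 1 0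
        - x 1 * y 0 * m 0 1 = 0
      · have e1 := h1 x₀ y h0
        -- When the slope vanishes at `x`, it is nonzero at both `x₀` and `x + x₀`; subtract.
        have e2 := h1 (x + x₀) y (by
          intro h3; apply h0; simp only [Pi.add_apply] at h3; linear_combination h3 - hx)
        simp only [Fin.sum_univ_two, Pi.add_apply] at e1 e2 ⊢
        linear_combination e2 - e1
      · exact h1 x y hx
    have n0 : m 1 1 * m 1 1 + m 0 1 * m 0 1 ≠ 0 := by
      intro h3
      have a1 : m 1 1 = 0 := by nlinarith [mul_self_nonneg (m 1 1), mul_self_nonneg (m 0 1)]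
      have a2 : m 0 1 = 0 := by nlinarith [mul_self_nonneg (m 1 1), mul_self_nonneg (m 0 1)]
      exact hm (by rw [a1, a2]; ring)
    have n1 : m 0 0 * m 0 0 + m 1 0 * m 1 0 ≠ 0 := by
      intro h3
      have a1 : m 0 0 = 0 := by nlinarith [mul_self_nonneg (m 0 0), mul_self_nonneg (m 1 0)]
      have a2 : m 1 0 = 0 := by nlinarith [mul_self_nonneg (m 0 0), mul_self_nonneg (m 1 0)]
      exact hm (by rw [a1, a2]; ring)
    have k0 : ∀ x : Fin 2 → ℝ,
        ∑ i, ∑ j, ρ i j * (x i * (![1, 0] : Fin 2 → ℝ) j) = 0 := fun x =>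
      h2 ![m 1 1, - m 0 1] x ![1, 0] (by simpa using n0)
    have k1 : ∀ x : Fin 2 → ℝ,
        ∑ i, ∑ j, ρ i j * (x i * (![0, 1] : Fin 2 → ℝ) j) = 0 := fun x =>
      h2 ![- m 1 0, m 0 0] x ![0, 1] (by simpa using n1)
    refine fin2 ?_ ?_ ?_ ?_
    · simpa using k0 ![1, 0]
    · simpa using k1 ![1, 0]
    · simpa using k0 ![0, 1]
    · simpa using k1 ![0, 1]

/-- Split the third mode along `z` and its normal. Any change of `m` keeps the form `m ⊗ z`, which
handles the component along `z`. For the normal component, peel off a rank-one term of `m` that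
leaves a rank-one remainder, and move the third factor of that term. -/
theorem OrthToLines.eq_zero_of_matrix_mul {r : Fin 2 → Fin 2 → Fin 2 → ℝ} (m : Fin 2 → Fin 2 → ℝ)
    (z : Fin 2 → ℝ) (hz : z 0 ≠ 0 ∨ z 1 ≠ 0) (h : OrthToLines (fun i j k => m i j * z k) r) :
    ∀ i j k, r i j k = 0 := by
  have h1 : ∀ p q, ∑ k, r p q k * z k = 0 := by
    intro p q
    have := h (fun i j k => (if i = p then 1 else 0) * (if j = q then 1 else 0) * z k) (fun t => by
      convert twoTerm_matrix_mul
        (fun i j => m i j + t * ((if i = p then 1 else 0) * (if j = q then 1 else 0))) z using 5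
      ring)
    fin_cases p <;> fin_cases q <;> simpa [Fin.sum_univ_two] using this
  have h2 : ∀ i j, ∑ k, r i j k * ![- z 1, z 0] k = 0 := by
    refine eq_zero_of_forall_subtract_singular m _ fun x y => ?_
    rintro ⟨s, p, q, hm⟩
    have := h (fun i j k => x i * y j * ![- z 1, z 0] k) (fun t =>
      ⟨x, y, fun k => s * z k + t * ![- z 1, z 0] k, p, q, z, fun i j k => by simp only [hm]; ring⟩)
    rw [← this]
    simp only [Fin.sum_univ_two]
    ring
  have hn : z 0 * z 0 + z 1 * z 1 ≠ 0 := by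
    intro h3
    rcases hz with hz | hz <;>
    exact hz (by nlinarith [mul_self_nonneg (z 0), mul_self_nonneg (z 1)])
  intro i j k
  have e1 := h1 i j
  have e2 := h2 i j
  simp only [Fin.sum_univ_two, Matrix.cons_val_zero, Matrix.cons_val_one] at e1 e2
  refine (mul_eq_zero.1 (?_ : (z 0 * z 0 + z 1 * z 1) * r i j k = 0)).resolve_left hn
  fin_cases k
  · simp only [Fin.zero_eta]
    linear_combination z 0 * e1 - z 1 * e2
  · simp only [Fin.mk_one]
    linear_combination z 1 * e1 + z 0 * e2

theorem OrthToLines.eq_zero_of_dependent {r : Fin 2 → Fin 2 → Fin 2 → ℝ}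
    {x y z x' y' z' : Fin 2 → ℝ} (hz : z 0 * z' 1 = z 1 * z' 0)
    (h : OrthToLines (fun i j k => x i * y j * z k + x' i * y' j * z' k) r) :
    ∀ i j k, r i j k = 0 := by
  obtain ⟨w, α, β, hw, h1, h2⟩ := exists_common_multiple_of_det_eq_zero z z' hz
  refine OrthToLines.eq_zero_of_matrix_mul (fun i j => α * (x i * y j) + β * (x' i * y' j)) w hw ?_
  convert h using 4
  rw [h1, h2]; ring

theorem exists_eq_add_of_det_ne_zero (x x' : Fin 2 → ℝ) (h : x 0 * x' 1 ≠ x 1 * x' 0)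
    (w : Fin 2 → ℝ) : ∃ α β : ℝ, ∀ i, w i = α * x i + β * x' i := by
  have h' : x 0 * x' 1 - x 1 * x' 0 ≠ 0 := sub_ne_zero.2 h
  refine ⟨(w 0 * x' 1 - w 1 * x' 0) / (x 0 * x' 1 - x 1 * x' 0),
    (x 0 * w 1 - x 1 * w 0) / (x 0 * x' 1 - x 1 * x' 0), fun i => ?_⟩
  rw [div_mul_eq_mul_div, div_mul_eq_mul_div, ← add_div, eq_div_iff h']
  fin_cases i <;> simp <;> ring

/-- Moving one factor of one term gives a line. In the product basis from the three pairs, each of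
the eight elements shares at least two factors with one of the two terms, so it is the direction of
such a line. -/
theorem OrthToLines.eq_zero_of_independent {r : Fin 2 → Fin 2 → Fin 2 → ℝ}
    {x y z x' y' z' : Fin 2 → ℝ} (hx : x 0 * x' 1 ≠ x 1 * x' 0) (hy : y 0 * y' 1 ≠ y 1 * y' 0)
    (hz : z 0 * z' 1 ≠ z 1 * z' 0)
    (h : OrthToLines (fun i j k => x i * y j * z k + x' i * y' j * z' k) r) :
    ∀ i j k, r i j k = 0 := by
  have h1 : ∀ w : Fin 2 → ℝ, ∑ i, ∑ j, ∑ k, r i j k * (w i * y j * z k) = 0 := fun w =>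
    h _ fun t => ⟨fun i => x i + t * w i, y, z, x', y', z', fun i j k => by ring⟩
  have h2 : ∀ w : Fin 2 → ℝ, ∑ i, ∑ j, ∑ k, r i j k * (x i * w j * z k) = 0 := fun w =>
    h _ fun t => ⟨x, fun i => y i + t * w i, z, x', y', z', fun i j k => by ring⟩
  have h3 : ∀ w : Fin 2 → ℝ, ∑ i, ∑ j, ∑ k, r i j k * (x i * y j * w k) = 0 := fun w =>
    h _ fun t => ⟨x, y, fun i => z i + t * w i, x', y', z', fun i j k => by ring⟩
  have h1' : ∀ w : Fin 2 → ℝ, ∑ i, ∑ j, ∑ k, r i j k * (w i * y' j * z' k) = 0 := fun w =>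
    h _ fun t => ⟨x, y, z, fun i => x' i + t * w i, y', z', fun i j k => by ring⟩
  have h2' : ∀ w : Fin 2 → ℝ, ∑ i, ∑ j, ∑ k, r i j k * (x' i * w j * z' k) = 0 := fun w =>
    h _ fun t => ⟨x, y, z, x', fun i => y' i + t * w i, z', fun i j k => by ring⟩
  have h3' : ∀ w : Fin 2 → ℝ, ∑ i, ∑ j, ∑ k, r i j k * (x' i * y' j * w k) = 0 := fun w =>
    h _ fun t => ⟨x, y, z, x', y', fun i => z' i + t * w i, fun i j k => by ring⟩
  have key : ∀ u v w : Fin 2 → ℝ, ∑ i, ∑ j, ∑ k, r i j k * (u i * v j * w k) = 0 := by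
    intro u v w
    obtain ⟨α, α', hu⟩ := exists_eq_add_of_det_ne_zero x x' hx u
    obtain ⟨β, β', hv⟩ := exists_eq_add_of_det_ne_zero y y' hy v
    obtain ⟨γ, γ', hw⟩ := exists_eq_add_of_det_ne_zero z z' hz w
    have e1 := h1 x
    have e2 := h1 x'
    have e3 := h2 y'
    have e4 := h3 z'
    have e1' := h1' x'
    have e2' := h1' x
    have e3' := h2' y
    have e4' := h3' z
    simp only [Fin.sum_univ_two] at *
    simp only [hu, hv, hw]
    linear_combination α * β * γ * e1 + α' * β * γ * e2 + α * β' * γ * e3 + α * β * γ' * e4 +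
      α' * β' * γ' * e1' + α * β' * γ' * e2' + α' * β * γ' * e3' + α' * β' * γ * e4'
  intro i j k
  have := key (Pi.single i 1) (Pi.single j 1) (Pi.single k 1)
  simpa [Pi.single_apply] using this

theorem OrthToLines.eq_zero {b r : Fin 2 → Fin 2 → Fin 2 → ℝ} (hb : TwoTerm b)
    (h : OrthToLines b r) : ∀ i j k, r i j k = 0 := by
  obtain ⟨x, y, z, x', y', z', hb⟩ := hb
  obtain rfl : b = fun i j k => x i * y j * z k + x' i * y' j * z' k := by
    funext i j k; exact hb i j k
  by_cases hz : z 0 * z' 1 = z 1 * z' 0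
  · exact h.eq_zero_of_dependent hz
  by_cases hx : x 0 * x' 1 = x 1 * x' 0
  · have h' : OrthToLines (fun i j k => y i * z j * x k + y' i * z' j * x' k)
        fun i j k => r k i j := by
      convert h.rotate using 4
      ring
    exact fun i j k => h'.eq_zero_of_dependent hx j k i
  by_cases hy : y 0 * y' 1 = y 1 * y' 0
  · have h' : OrthToLines (fun i j k => z i * x j * y k + z' i * x' j * y' k)
        fun i j k => r j k i := by
      convert h.rotate.rotate using 4
      ring
    exact fun i j k => h'.eq_zero_of_dependent hy k i j
  exact h.eq_zero_of_independent hx hy hz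

/-- A `2 × 2 × 2` tensor with a best rank-two approximation has rank at most two itself. -/
theorem eq_of_isBestApprox_two {a b : Tensor3 2 2 2} (hb : IsSumOfOuter b 2)
    (h : ∀ c, IsSumOfOuter c 2 → ‖a - b‖ ≤ ‖a - c‖) : a = b := by
  have hr : OrthToLines (fun i j k => b (i, j, k)) fun i j k => (a - b) (i, j, k) := by
    intro E hE
    set e : Tensor3 2 2 2 := WithLp.toLp 2 fun p => E p.1 p.2.1 p.2.2 with he
    have h1 : ∑ i, ∑ j, ∑ k, (a - b) (i, j, k) * E i j k = inner ℝ (a - b) e := by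
      simp [PiLp.inner_apply, Fintype.sum_prod_type, he, mul_comm]
    have h2 : ∀ t : ℝ, 0 ≤ t ^ 2 * ‖e‖ ^ 2 - 2 * t * inner ℝ (a - b) e := by
      intro t
      have h3 := h (b + t • e) (isSumOfOuter_two_iff_twoTerm.2 (hE t))
      have h4 : ‖a - (b + t • e)‖ ^ 2 = ‖a - b‖ ^ 2 - 2 * t * inner ℝ (a - b) e
          + t ^ 2 * ‖e‖ ^ 2 := by
        rw [← sub_sub, norm_sub_sq_real, inner_smul_right, norm_smul, mul_pow, Real.norm_eq_abs,
          sq_abs]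
        ring
      have h5 := pow_le_pow_left₀ (norm_nonneg _) h3 2
      linarith
    rw [h1]
    set s := inner ℝ (a - b) e
    -- Nearly the minimizer of the quadratic; the `+ 1` covers `e = 0`.
    have h6 := h2 (s / (‖e‖ ^ 2 + 1))
    have h7 : 0 < ‖e‖ ^ 2 + 1 := by positivity
    have h8 : (s / (‖e‖ ^ 2 + 1)) ^ 2 * ‖e‖ ^ 2 - 2 * (s / (‖e‖ ^ 2 + 1)) * s =
        - (s ^ 2 * (‖e‖ ^ 2 + 2)) / (‖e‖ ^ 2 + 1) ^ 2 := by
      field_simp; ring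
    rw [h8, le_div_iff₀ (by positivity), zero_mul] at h6
    have h9 : 0 ≤ s ^ 2 * ‖e‖ ^ 2 := by positivity
    exact pow_eq_zero_iff two_ne_zero |>.1 (le_antisymm (by nlinarith) (sq_nonneg s))
  refine sub_eq_zero.1 ?_
  ext ⟨i, j, k⟩
  exact hr.eq_zero (isSumOfOuter_two_iff_twoTerm.1 hb) i j k

/-! ### Degenerate arrays and the hyperdeterminant -/

/-- All fibres in the third mode lie on the line normal to `q`, so `b` is a matrix times a vector.
-/
theorem twoTerm_of_annihilator {b : Fin 2 → Fin 2 → Fin 2 → ℝ} (q : Fin 2 → ℝ)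
    (hq : q 0 ≠ 0 ∨ q 1 ≠ 0) (h : ∀ i j, b i j 0 * q 0 + b i j 1 * q 1 = 0) : TwoTerm b := by
  rcases hq with hq | hq
  · convert twoTerm_matrix_mul (fun i j => b i j 1) ![- (q 1 / q 0), 1] using 4 with i j k
    fin_cases k <;> simp
    field_simp
    linear_combination h i j
  · convert twoTerm_matrix_mul (fun i j => b i j 0) ![1, - (q 0 / q 1)] using 4 with i j k
    fin_cases k <;> simp
    field_simp
    linear_combination h i j

/-- The hyperdeterminant of a `2 × 2 × 2` tensor: the discriminant of the pencil of its slabs. -/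
def hyperdet (a : Tensor3 2 2 2) : ℝ :=
  (a (0, 0, 0) * a (1, 1, 1) + a (0, 1, 1) * a (1, 0, 0) - a (0, 0, 1) * a (1, 1, 0)
    - a (0, 1, 0) * a (1, 0, 1)) ^ 2
  - 4 * (a (0, 0, 0) * a (0, 1, 1) - a (0, 0, 1) * a (0, 1, 0))
    * (a (1, 0, 0) * a (1, 1, 1) - a (1, 0, 1) * a (1, 1, 0))

theorem continuous_hyperdet : Continuous hyperdet := by
  unfold hyperdet; fun_prop

theorem hyperdet_G₃_neg : hyperdet G₃ < 0 := by
  simp [hyperdet, G₃]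

theorem hyperdet_nonneg {a : Tensor3 2 2 2} (h : IsSumOfOuter a 2) : 0 ≤ hyperdet a := by
  obtain ⟨x, y, z, x', y', z', rfl⟩ := isSumOfOuter_two_iff.1 h
  have : hyperdet (outer x y z + outer x' y' z') = ((x 0 * x' 1 - x 1 * x' 0) *
      (y 0 * y' 1 - y 1 * y' 0) * (z 0 * z' 1 - z 1 * z' 0)) ^ 2 := by
    simp only [hyperdet, PiLp.add_apply, outer_apply]; ring
  rw [this]; positivity

theorem hyperdet_mulAct_left (L : Matrix (Fin 2) (Fin 2) ℝ) (a : Tensor3 2 2 2) :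
    hyperdet (mulAct L 1 1 a) = L.det ^ 2 * hyperdet a := by
  simp only [hyperdet, mulAct_apply, Fin.sum_univ_two, Matrix.det_fin_two, Matrix.one_apply_eq,
    Matrix.one_apply_ne, ne_eq, zero_ne_one, one_ne_zero, not_false_eq_true]
  ring

theorem hyperdet_mulAct_middle (M : Matrix (Fin 2) (Fin 2) ℝ) (a : Tensor3 2 2 2) :
    hyperdet (mulAct 1 M 1 a) = M.det ^ 2 * hyperdet a := by
  simp only [hyperdet, mulAct_apply, Fin.sum_univ_two, Matrix.det_fin_two, Matrix.one_apply_eq,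
    Matrix.one_apply_ne, ne_eq, zero_ne_one, one_ne_zero, not_false_eq_true]
  ring

theorem hyperdet_mulAct_right (N : Matrix (Fin 2) (Fin 2) ℝ) (a : Tensor3 2 2 2) :
    hyperdet (mulAct 1 1 N a) = N.det ^ 2 * hyperdet a := by
  simp only [hyperdet, mulAct_apply, Fin.sum_univ_two, Matrix.det_fin_two, Matrix.one_apply_eq,
    Matrix.one_apply_ne, ne_eq, zero_ne_one, one_ne_zero, not_false_eq_true]
  ring

theorem hyperdet_mulAct (L M N : Matrix (Fin 2) (Fin 2) ℝ) (a : Tensor3 2 2 2) :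
    hyperdet (mulAct L M N a) = (L.det * M.det * N.det) ^ 2 * hyperdet a := by
  have : mulAct L M N a =
      mulAct L 1 1 (mulAct 1 M 1 (mulAct 1 1 N a : Tensor3 2 2 2) : Tensor3 2 2 2) := by
    simp only [mulAct_mulAct, mul_one, one_mul]
  rw [this, hyperdet_mulAct_left, hyperdet_mulAct_middle, hyperdet_mulAct_right]
  ring

theorem hyperdet_mulAct_neg {L M N : Matrix (Fin 2) (Fin 2) ℝ} {a : Tensor3 2 2 2}
    (hL : L.det ≠ 0) (hM : M.det ≠ 0) (hN : N.det ≠ 0) (ha : hyperdet a < 0) :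
    hyperdet (mulAct L M N a) < 0 := by
  rw [hyperdet_mulAct]
  exact mul_neg_of_pos_of_neg (by positivity) ha

theorem exists_row_ne_zero {K : Matrix (Fin 2) (Fin 2) ℝ} (hK : K ≠ 0) :
    ∃ p, K p 0 ≠ 0 ∨ K p 1 ≠ 0 := by
  contrapose! hK
  ext i j
  fin_cases j
  exacts [(hK i).1, (hK i).2]

theorem isSumOfOuter_two_of_mulAct_right {K : Matrix (Fin 2) (Fin 2) ℝ} {a : Tensor3 2 2 2}
    (hK : K ≠ 0) (h : (mulAct 1 1 K a : Tensor3 2 2 2) = 0) : IsSumOfOuter a 2 := by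
  obtain ⟨p, hp⟩ := exists_row_ne_zero hK
  rw [isSumOfOuter_two_iff_twoTerm]
  refine twoTerm_of_annihilator (K p) hp fun i j => ?_
  have := congrArg (fun c : Tensor3 2 2 2 => c (i, j, p)) h
  simp only [mulAct_apply, Matrix.one_apply, Fin.sum_univ_two] at this
  fin_cases i <;> fin_cases j <;> simp at this <;> simp <;> linarith

theorem isSumOfOuter_two_of_mulAct_left {K : Matrix (Fin 2) (Fin 2) ℝ} {a : Tensor3 2 2 2}
    (hK : K ≠ 0) (h : (mulAct K 1 1 a : Tensor3 2 2 2) = 0) : IsSumOfOuter a 2 := by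
  obtain ⟨p, hp⟩ := exists_row_ne_zero hK
  rw [isSumOfOuter_two_iff_twoTerm]
  refine (twoTerm_of_annihilator (b := fun j k i => a (i, j, k)) (K p) hp fun i j =>
    ?_).rotate.rotate
  have := congrArg (fun c : Tensor3 2 2 2 => c (p, i, j)) h
  simp only [mulAct_apply, Matrix.one_apply, Fin.sum_univ_two] at this
  fin_cases i <;> fin_cases j <;> simp at this <;> simp <;> linarith

theorem isSumOfOuter_two_of_mulAct_middle {K : Matrix (Fin 2) (Fin 2) ℝ} {a : Tensor3 2 2 2}
    (hK : K ≠ 0) (h : (mulAct 1 K 1 a : Tensor3 2 2 2) = 0) : IsSumOfOuter a 2 := by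
  obtain ⟨p, hp⟩ := exists_row_ne_zero hK
  rw [isSumOfOuter_two_iff_twoTerm]
  refine (twoTerm_of_annihilator (b := fun k i j => a (i, j, k)) (K p) hp
    fun k i => ?_).rotate
  have := congrArg (fun c : Tensor3 2 2 2 => c (i, p, k)) h
  simp only [mulAct_apply, Matrix.one_apply, Fin.sum_univ_two] at this
  fin_cases i <;> fin_cases k <;> simp at this <;> simp <;> linarith

/-! ### Orthonormal frames and compressions -/

/-- The matrices whose two columns are orthonormal. -/
def frames (d : ℕ) : Set (Matrix (Fin d) (Fin 2) ℝ) := {U | Uᵀ * U = 1}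

theorem isCompact_frames (d : ℕ) : IsCompact (frames d) := by
  have h1 : IsCompact (Set.univ.pi fun _ => Set.univ.pi fun _ => Set.Icc (-1) 1 :
      Set (Fin d → Fin 2 → ℝ)) :=
    isCompact_univ_pi fun _ => isCompact_univ_pi fun _ => isCompact_Icc
  refine IsCompact.of_isClosed_subset (X := Matrix (Fin d) (Fin 2) ℝ) h1 ?_ ?_
  · exact isClosed_eq (by fun_prop) continuous_const
  · intro U hU i _ j _
    have h2 : ∑ k, U k j * U k j = 1 := by
      have := congrFun (congrFun hU j) j
      simpa [Matrix.mul_apply] using this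
    have h3 := Finset.single_le_sum (fun k _ => mul_self_nonneg (U k j)) (Finset.mem_univ i)
    rw [h2] at h3
    exact abs_le.1 (abs_le_one_iff_mul_self_le_one.2 h3)

/-- Two vectors lie in the span of an orthonormal pair. -/
theorem exists_frame {d : ℕ} (hd : 2 ≤ d) (x : Fin 2 → Fin d → ℝ) :
    ∃ U ∈ frames d, ∀ s, (U * Uᵀ) *ᵥ x s = x s := by
  -- Padding by zeros lets Gram–Schmidt return a full orthonormal basis even when the two vectors
  -- are dependent; triangularity puts both in the span of its first two members.
  let f : Fin d → EuclideanSpace ℝ (Fin d) := fun i =>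
    if h : (i : ℕ) < 2 then WithLp.toLp 2 (x ⟨i, h⟩) else 0
  let b := InnerProductSpace.gramSchmidtOrthonormalBasis (𝕜 := ℝ) (by simp) f
  let c : Fin 2 → Fin d := Fin.castLE hd
  have hc : StrictMono c := Fin.strictMono_castLE hd
  refine ⟨Matrix.of fun i j => b (c j) i, ?_, fun s => ?_⟩
  · ext i j
    have := orthonormal_iff_ite.1 b.orthonormal (c j) (c i)
    simp only [PiLp.inner_apply, RCLike.inner_apply, conj_trivial] at this
    simp only [Matrix.mul_apply, Matrix.transpose_apply, Matrix.of_apply, Matrix.one_apply]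
    rw [this]
    simp [hc.injective.eq_iff, eq_comm]
  · have hs : f (c s) = WithLp.toLp 2 (x s) := dif_pos s.isLt
    have h1 := b.sum_repr' (f (c s))
    have h2 : ∑ i, inner ℝ (b i) (f (c s)) • b i = ∑ j, inner ℝ (b (c j)) (f (c s)) • b (c j) := by
      symm
      refine (Finset.sum_map Finset.univ ⟨c, hc.injective⟩
        fun i => inner ℝ (b i) (f (c s)) • b i).symm.trans ?_
      refine Finset.sum_subset (Finset.subset_univ _) fun i _ hi => ?_
      have hi2 : c 1 < i := by
        by_contra hlt
        apply hi
        have : (i : ℕ) < 2 := by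
          have : (i : ℕ) ≤ 1 := not_lt.1 hlt
          omega
        exact Finset.mem_map.2 ⟨⟨i, this⟩, Finset.mem_univ _, by ext; simp [c]⟩
      have : c s < i := lt_of_le_of_lt (hc.monotone (by omega)) hi2
      rw [InnerProductSpace.gramSchmidtOrthonormalBasis_inv_triangular _ _ this, zero_smul]
    rw [h2, hs] at h1
    ext i
    have h3 := congrArg (fun v : EuclideanSpace ℝ (Fin d) => v i) h1
    simp only [WithLp.ofLp_sum, Finset.sum_apply, PiLp.smul_apply, smul_eq_mul,
      PiLp.inner_apply, RCLike.inner_apply, conj_trivial] at h3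
    rw [← h3, ← Matrix.mulVec_mulVec]
    simp only [Matrix.mulVec, dotProduct, Matrix.of_apply, Matrix.transpose_apply]
    refine Finset.sum_congr rfl fun j _ => ?_
    rw [mul_comm]
    congr 1
    exact Finset.sum_congr rfl fun k _ => mul_comm _ _

theorem exists_frame_matrix {d : ℕ} (hd : 2 ≤ d) (P : Matrix (Fin d) (Fin 2) ℝ) :
    ∃ U ∈ frames d, U * (Uᵀ * P) = P := by
  obtain ⟨U, hU, h⟩ := exists_frame hd fun s i => P i s
  refine ⟨U, hU, ?_⟩
  ext i s
  rw [← Matrix.mul_assoc]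
  exact congrFun (h s) i

section

variable {d₁ d₂ d₃ : ℕ}

theorem IsSumOfOuter.exists_frames (hd₁ : 2 ≤ d₁) (hd₂ : 2 ≤ d₂) (hd₃ : 2 ≤ d₃)
    {B : Tensor3 d₁ d₂ d₃} (h : IsSumOfOuter B 2) :
    ∃ U ∈ frames d₁, ∃ V ∈ frames d₂, ∃ W ∈ frames d₃,
      mulAct U V W (mulAct Uᵀ Vᵀ Wᵀ B) = B := by
  obtain ⟨x, y, z, rfl⟩ := h
  obtain ⟨U, hU, hx⟩ := exists_frame hd₁ x
  obtain ⟨V, hV, hy⟩ := exists_frame hd₂ y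
  obtain ⟨W, hW, hz⟩ := exists_frame hd₃ z
  refine ⟨U, hU, V, hV, W, hW, ?_⟩
  rw [mulAct_mulAct, ← mulActₗ_apply, map_sum]
  refine Finset.sum_congr rfl fun s _ => ?_
  rw [mulActₗ_apply, mulAct_outer, hx, hy, hz]

theorem mulAct_transpose_mulAct {U : Matrix (Fin d₁) (Fin 2) ℝ} {V : Matrix (Fin d₂) (Fin 2) ℝ}
    {W : Matrix (Fin d₃) (Fin 2) ℝ} (hU : U ∈ frames d₁) (hV : V ∈ frames d₂)
    (hW : W ∈ frames d₃) (a : Tensor3 2 2 2) : mulAct Uᵀ Vᵀ Wᵀ (mulAct U V W a) = a := by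
  rw [mulAct_mulAct, hU, hV, hW, mulAct_one]

theorem norm_sub_mulAct_sq {U : Matrix (Fin d₁) (Fin 2) ℝ} {V : Matrix (Fin d₂) (Fin 2) ℝ}
    {W : Matrix (Fin d₃) (Fin 2) ℝ} (hU : U ∈ frames d₁) (hV : V ∈ frames d₂)
    (hW : W ∈ frames d₃) (A : Tensor3 d₁ d₂ d₃) (c : Tensor3 2 2 2) :
    ‖A - mulAct U V W c‖ ^ 2 = ‖mulAct Uᵀ Vᵀ Wᵀ A - c‖ ^ 2
      + ‖A - mulAct U V W (mulAct Uᵀ Vᵀ Wᵀ A)‖ ^ 2 :=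
  norm_sub_sq_of_section (mulActₗ U V W) (mulActₗ Uᵀ Vᵀ Wᵀ)
    (fun x y => inner_mulAct U V W x y) (mulAct_transpose_mulAct hU hV hW) c A

/-- If a best rank-two approximation of `A` lies in the subspace of three frames, then the
compression of `A` to that subspace has rank at most two. -/
theorem isSumOfOuter_compression {U : Matrix (Fin d₁) (Fin 2) ℝ} {V : Matrix (Fin d₂) (Fin 2) ℝ}
    {W : Matrix (Fin d₃) (Fin 2) ℝ} (hU : U ∈ frames d₁) (hV : V ∈ frames d₂)
    (hW : W ∈ frames d₃) {A B : Tensor3 d₁ d₂ d₃} (hB : IsSumOfOuter B 2)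
    (hAB : ∀ C, IsSumOfOuter C 2 → ‖A - B‖ ≤ ‖A - C‖)
    (h : mulAct U V W (mulAct Uᵀ Vᵀ Wᵀ B) = B) : IsSumOfOuter (mulAct Uᵀ Vᵀ Wᵀ A) 2 := by
  have hb := hB.map Uᵀ Vᵀ Wᵀ
  rw [eq_of_isBestApprox_two (a := mulAct Uᵀ Vᵀ Wᵀ A) hb]
  · exact hb
  · intro c hc
    -- By Pythagoras, the distances from `A` to tensors in the frame subspace and those between the
    -- cores differ, once squared, by a constant, so the core of `B` is a best approximation of the
    -- compression.
    have h1 := pow_le_pow_left₀ (norm_nonneg _) (hAB _ (hc.map U V W)) 2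
    have h2 := norm_sub_mulAct_sq hU hV hW A c
    have h3 := norm_sub_mulAct_sq hU hV hW A (mulAct Uᵀ Vᵀ Wᵀ B)
    rw [h] at h3
    exact le_of_sq_le_sq (by linarith) (norm_nonneg _)

/-! ### Tensors of type `G₃` in frame coordinates -/

/-- The leading `2` columns of the identity matrix. -/
def leadingColumns (d : ℕ) : Matrix (Fin d) (Fin 2) ℝ :=
  Matrix.of fun p i => if (p : ℕ) = i then 1 else 0

theorem transpose_mul_leadingColumns {d : ℕ} (hd : 2 ≤ d) :
    (leadingColumns d)ᵀ * leadingColumns d = 1 := by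
  ext i j
  rw [Matrix.mul_apply, Finset.sum_eq_single (Fin.castLE hd i)]
  · simp [leadingColumns, Matrix.one_apply, Fin.ext_iff]
  · intro k _ hk
    have : (k : ℕ) ≠ i := fun h => hk (Fin.ext h)
    simp [leadingColumns, this]
  · simp

theorem sum_leadingColumns_mul {d : ℕ} (p : Fin d) (f : Fin 2 → ℝ) :
    ∑ i, leadingColumns d p i * f i = if h : (p : ℕ) < 2 then f ⟨p, h⟩ else 0 := by
  split_ifs with h
  · rw [Finset.sum_eq_single ⟨p, h⟩]
    · simp [leadingColumns]
    · intro i _ hi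
      have : (p : ℕ) ≠ i := fun h => hi (Fin.ext h.symm)
      simp [leadingColumns, this]
    · simp
  · refine Finset.sum_eq_zero fun i _ => ?_
    have : (p : ℕ) ≠ i := by omega
    simp [leadingColumns, this]

theorem extend_eq_mulAct (a : Tensor3 2 2 2) :
    extend d₁ d₂ d₃ a = mulAct (leadingColumns d₁) (leadingColumns d₂) (leadingColumns d₃) a := by
  ext ⟨p, q, r⟩
  simp only [mulAct_apply, mul_assoc, ← Finset.mul_sum, sum_leadingColumns_mul]
  simp only [extend]
  split_ifs <;> first | rfl | tauto

theorem isTypeG₃_extend_G₃ : IsTypeG₃ (extend d₁ d₂ d₃ G₃) :=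
  ⟨1, 1, 1, by simp [mulAct_one]⟩

theorem exists_frame_factorization {d : ℕ} (hd : 2 ≤ d) (L : GL (Fin d) ℝ) :
    ∃ U ∈ frames d, ∃ T : Matrix (Fin 2) (Fin 2) ℝ, T.det ≠ 0 ∧
      (↑L⁻¹ : Matrix (Fin d) (Fin d) ℝ) * leadingColumns d = U * T := by
  obtain ⟨U, hU, h⟩ := exists_frame_matrix hd ((↑L⁻¹ : Matrix (Fin d) (Fin d) ℝ) * leadingColumns d)
  refine ⟨U, hU, _, ?_, h.symm⟩
  set T := Uᵀ * ((↑L⁻¹ : Matrix (Fin d) (Fin d) ℝ) * leadingColumns d)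
  have h1 : ((leadingColumns d)ᵀ * (L : Matrix (Fin d) (Fin d) ℝ) * U) * T = 1 := by
    rw [Matrix.mul_assoc, h, Matrix.mul_assoc, ← Matrix.mul_assoc (L : Matrix (Fin d) (Fin d) ℝ),
      Units.mul_inv, Matrix.one_mul, transpose_mul_leadingColumns hd]
  intro h0
  have := congrArg Matrix.det h1
  rw [Matrix.det_mul, h0, mul_zero, Matrix.det_one] at this
  exact zero_ne_one this

theorem IsTypeG₃.exists_frames (hd₁ : 2 ≤ d₁) (hd₂ : 2 ≤ d₂) (hd₃ : 2 ≤ d₃)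
    {A : Tensor3 d₁ d₂ d₃} (h : IsTypeG₃ A) :
    ∃ U ∈ frames d₁, ∃ V ∈ frames d₂, ∃ W ∈ frames d₃, ∃ a : Tensor3 2 2 2,
      hyperdet a < 0 ∧ A = mulAct U V W a := by
  obtain ⟨L, M, N, h⟩ := h
  obtain ⟨U, hU, T₁, hT₁, h1⟩ := exists_frame_factorization hd₁ L
  obtain ⟨V, hV, T₂, hT₂, h2⟩ := exists_frame_factorization hd₂ M
  obtain ⟨W, hW, T₃, hT₃, h3⟩ := exists_frame_factorization hd₃ N
  refine ⟨U, hU, V, hV, W, hW, mulAct T₁ T₂ T₃ G₃,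
    hyperdet_mulAct_neg hT₁ hT₂ hT₃ hyperdet_G₃_neg, ?_⟩
  have h4 := congrArg (mulAct (↑L⁻¹ : Matrix (Fin d₁) (Fin d₁) ℝ)
    (↑M⁻¹ : Matrix (Fin d₂) (Fin d₂) ℝ) (↑N⁻¹ : Matrix (Fin d₃) (Fin d₃) ℝ)) h
  rw [mulAct_mulAct, Units.inv_mul, Units.inv_mul, Units.inv_mul, mulAct_one, extend_eq_mulAct,
    mulAct_mulAct, h1, h2, h3, ← mulAct_mulAct] at h4
  exact h4.symm

/-! ### The limit argument -/

/-- A tensor in the subspace of three frames whose hyperdeterminant there is negative is interior to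
the set of tensors without best rank-two approximation. -/
theorem mem_interior_noBestApprox (hd₁ : 2 ≤ d₁) (hd₂ : 2 ≤ d₂) (hd₃ : 2 ≤ d₃)
    {U₀ : Matrix (Fin d₁) (Fin 2) ℝ} {V₀ : Matrix (Fin d₂) (Fin 2) ℝ}
    {W₀ : Matrix (Fin d₃) (Fin 2) ℝ} (hU₀ : U₀ ∈ frames d₁) (hV₀ : V₀ ∈ frames d₂)
    (hW₀ : W₀ ∈ frames d₃) {a₀ : Tensor3 2 2 2} (ha₀ : hyperdet a₀ < 0) :
    mulAct U₀ V₀ W₀ a₀ ∈ interior (noBestApprox d₁ d₂ d₃ 2) := by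
  by_contra hcon
  set A₀ := mulAct U₀ V₀ W₀ a₀ with hA₀
  rw [← Set.mem_compl_iff, ← closure_compl, mem_closure_iff_ultrafilter] at hcon
  obtain ⟨g, hgS, hg⟩ := hcon
  have hex : ∀ A : Tensor3 d₁ d₂ d₃, A ∈ (noBestApprox d₁ d₂ d₃ 2)ᶜ →
      ∃ (B : Tensor3 d₁ d₂ d₃) (U : Matrix (Fin d₁) (Fin 2) ℝ) (V : Matrix (Fin d₂) (Fin 2) ℝ)
        (W : Matrix (Fin d₃) (Fin 2) ℝ), IsSumOfOuter B 2 ∧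
        (∀ C, IsSumOfOuter C 2 → ‖A - B‖ ≤ ‖A - C‖) ∧ U ∈ frames d₁ ∧ V ∈ frames d₂ ∧
        W ∈ frames d₃ ∧ mulAct U V W (mulAct Uᵀ Vᵀ Wᵀ B) = B := by
    intro A hA
    obtain ⟨B, hB, hAB⟩ := not_not.1 hA
    obtain ⟨U, hU, V, hV, W, hW, h⟩ := (rank_le_iff.1 hB).exists_frames hd₁ hd₂ hd₃
    exact ⟨B, U, V, W, rank_le_iff.1 hB, fun C hC => hAB C (rank_le_iff.2 hC), hU, hV, hW, h⟩
  choose! B U V W hB hAB hU hV hW hBfix using hex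
  have hid : Tendsto (fun A : Tensor3 d₁ d₂ d₃ => A) g (𝓝 A₀) := hg
  have hS : ∀ᶠ A in (g : Filter (Tensor3 d₁ d₂ d₃)), A ∈ (noBestApprox d₁ d₂ d₃ 2)ᶜ := hgS
  have hlim : ∀ {X : Type} [TopologicalSpace X] {K : Set X} (hK : IsCompact K)
      (f : Tensor3 d₁ d₂ d₃ → X), (∀ᶠ A in (g : Filter (Tensor3 d₁ d₂ d₃)), f A ∈ K) →
      ∃ x ∈ K, Tendsto f g (𝓝 x) := fun hK f hf => hK.ultrafilter_le_nhds' (g.map f) hf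
  obtain ⟨U₁, hU₁, hUlim⟩ := hlim (isCompact_frames d₁) U (hS.mono hU)
  obtain ⟨V₁, hV₁, hVlim⟩ := hlim (isCompact_frames d₂) V (hS.mono hV)
  obtain ⟨W₁, hW₁, hWlim⟩ := hlim (isCompact_frames d₃) W (hS.mono hW)
  have hzero : IsSumOfOuter (0 : Tensor3 d₁ d₂ d₃) 2 :=
    isSumOfOuter_two_iff.2 ⟨0, 0, 0, 0, 0, 0, by ext ⟨i, j, k⟩; simp⟩
  obtain ⟨B₁, -, hBlim⟩ := hlim (isCompact_closedBall (0 : Tensor3 d₁ d₂ d₃) (2 * (‖A₀‖ + 1))) B (by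
    have h1 : ∀ᶠ A in (g : Filter (Tensor3 d₁ d₂ d₃)), ‖A‖ < ‖A₀‖ + 1 :=
      hid.norm.eventually_lt_const (lt_add_one _)
    filter_upwards [hS, h1] with A hA hA1
    have h2 := hAB A hA 0 hzero
    have h3 : ‖B A‖ ≤ ‖A‖ + ‖A - B A‖ := by
      simpa using norm_sub_le A (A - B A)
    rw [sub_zero] at h2
    rw [mem_closedBall_zero_iff]
    linarith)
  -- `B₁` minimizes the distance to `A₀` over the closure of the tensors of rank at most two
  have hmin : ∀ C, IsSumOfOuter C 2 → ‖A₀ - B₁‖ ≤ ‖A₀ - C‖ := fun C hC =>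
    le_of_tendsto_of_tendsto (hid.sub hBlim).norm (hid.sub tendsto_const_nhds).norm
      (hS.mono fun A hA => hAB A hA C hC)
  have hproj : Tendsto (fun A => mulAct U₀ V₀ W₀ (mulAct U₀ᵀ V₀ᵀ W₀ᵀ (B A))) g
      (𝓝 (mulAct U₀ V₀ W₀ (mulAct U₀ᵀ V₀ᵀ W₀ᵀ B₁))) :=
    tendsto_mulAct tendsto_const_nhds tendsto_const_nhds tendsto_const_nhds
      (tendsto_mulAct tendsto_const_nhds tendsto_const_nhds tendsto_const_nhds hBlim)
  set b := mulAct U₀ᵀ V₀ᵀ W₀ᵀ B₁ with hb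
  clear_value b
  -- `B₁` is only a limit of tensors of rank at most two, so the projected `B A` serve as
  -- competitors before passing to the limit.
  have hminb : ‖A₀ - B₁‖ ≤ ‖A₀ - mulAct U₀ V₀ W₀ b‖ :=
    ge_of_tendsto (tendsto_const_nhds.sub hproj).norm
      (hS.mono fun A hA => hmin _ (((hB A hA).map _ _ _).map _ _ _))
  -- `A₀` lies in the subspace, so projecting `B₁` would strictly reduce its distance to `A₀` unless
  -- `B₁` is already there.
  have hB₁ : mulAct U₀ V₀ W₀ b = B₁ := by
    have h1 := norm_sub_mulAct_sq hU₀ hV₀ hW₀ B₁ a₀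
    have h2 := norm_sub_mulAct_sq hU₀ hV₀ hW₀ (mulAct U₀ V₀ W₀ b) a₀
    rw [mulAct_transpose_mulAct hU₀ hV₀ hW₀, sub_self, norm_zero] at h2
    rw [← hA₀, norm_sub_rev, ← hb] at h1
    rw [← hA₀, norm_sub_rev] at h2
    have h3 := pow_le_pow_left₀ (norm_nonneg _) hminb 2
    have h4 : ‖B₁ - mulAct U₀ V₀ W₀ b‖ = 0 := by
      refine pow_eq_zero_iff two_ne_zero |>.1 (le_antisymm ?_ (sq_nonneg _))
      linarith
    exact (sub_eq_zero.1 (norm_eq_zero.1 h4)).symm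
  have hbnot : ¬ IsSumOfOuter b 2 := by
    intro hb2
    have : IsSumOfOuter (mulAct U₀ᵀ V₀ᵀ W₀ᵀ A₀) 2 :=
      isSumOfOuter_compression hU₀ hV₀ hW₀ (hB₁ ▸ hb2.map U₀ V₀ W₀) hmin
        (by rw [← hb, hB₁])
    rw [hA₀, mulAct_transpose_mulAct hU₀ hV₀ hW₀] at this
    exact absurd (hyperdet_nonneg this) (not_le.2 ha₀)
  have ht : ∀ {d : ℕ}, Continuous fun M : Matrix (Fin d) (Fin 2) ℝ => Mᵀ := by
    intro d; fun_prop
  have hfix : mulAct U₁ V₁ W₁ (mulAct U₁ᵀ V₁ᵀ W₁ᵀ B₁) = B₁ := by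
    have h1 := tendsto_mulAct hUlim hVlim hWlim (tendsto_mulAct ((ht.tendsto _).comp hUlim)
      ((ht.tendsto _).comp hVlim) ((ht.tendsto _).comp hWlim) hBlim)
    exact tendsto_nhds_unique (h1.congr' (hS.mono fun A hA => hBfix A hA)) hBlim
  have hdet : ∀ {d : ℕ} {P Q : Matrix (Fin d) (Fin 2) ℝ},
      Pᵀ * (Q * Qᵀ) * P - 1 = 0 → (Qᵀ * P).det ≠ 0 := by
    intro d P Q h h0
    have h1 := congrArg Matrix.det (sub_eq_zero.1 h)
    rw [Matrix.mul_assoc, Matrix.mul_assoc, ← Matrix.mul_assoc Pᵀ, Matrix.det_mul, h0, mul_zero,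
      Matrix.det_one] at h1
    exact zero_ne_one h1
  -- The projection `U₁ * U₁ᵀ` fixes `B₁`, so in `U₀` coordinates `U₀ᵀ * (U₁ * U₁ᵀ) * U₀ - 1` kills
  -- `b`. It must vanish, since a nonzero matrix killing `b` in one mode would force rank at most
  -- two.
  have hdetU : (U₁ᵀ * U₀).det ≠ 0 := by
    refine hdet (by_contra fun hK => hbnot (isSumOfOuter_two_of_mulAct_left hK ?_))
    have h1 : mulAct (U₁ * U₁ᵀ) 1 1 B₁ = B₁ := by
      rw [← hfix, mulAct_mulAct, Matrix.mul_assoc, hU₁, Matrix.mul_one, Matrix.one_mul,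
        Matrix.one_mul]
    have h2 : mulAct (U₀ᵀ * (U₁ * U₁ᵀ) * U₀) 1 1 b = b := by
      conv_rhs => rw [hb, ← h1, ← hB₁]
      rw [mulAct_mulAct, mulAct_mulAct, Matrix.mul_one, Matrix.mul_one, hV₀, hW₀,
        ← Matrix.mul_assoc]
    rw [mulAct_sub_left, h2, mulAct_one, sub_self]
  have hdetV : (V₁ᵀ * V₀).det ≠ 0 := by
    refine hdet (by_contra fun hK => hbnot (isSumOfOuter_two_of_mulAct_middle hK ?_))
    have h1 : mulAct 1 (V₁ * V₁ᵀ) 1 B₁ = B₁ := by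
      rw [← hfix, mulAct_mulAct, Matrix.mul_assoc, hV₁, Matrix.mul_one, Matrix.one_mul,
        Matrix.one_mul]
    have h2 : mulAct 1 (V₀ᵀ * (V₁ * V₁ᵀ) * V₀) 1 b = b := by
      conv_rhs => rw [hb, ← h1, ← hB₁]
      rw [mulAct_mulAct, mulAct_mulAct, Matrix.mul_one, Matrix.mul_one, hU₀, hW₀,
        ← Matrix.mul_assoc]
    rw [mulAct_sub_middle, h2, mulAct_one, sub_self]
  have hdetW : (W₁ᵀ * W₀).det ≠ 0 := by
    refine hdet (by_contra fun hK => hbnot (isSumOfOuter_two_of_mulAct_right hK ?_))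
    have h1 : mulAct 1 1 (W₁ * W₁ᵀ) B₁ = B₁ := by
      rw [← hfix, mulAct_mulAct, Matrix.mul_assoc, hW₁, Matrix.mul_one, Matrix.one_mul,
        Matrix.one_mul]
    have h2 : mulAct 1 1 (W₀ᵀ * (W₁ * W₁ᵀ) * W₀) b = b := by
      conv_rhs => rw [hb, ← h1, ← hB₁]
      rw [mulAct_mulAct, mulAct_mulAct, Matrix.mul_one, Matrix.mul_one, hU₀, hV₀,
        ← Matrix.mul_assoc]
    rw [mulAct_sub_right, h2, mulAct_one, sub_self]
  have hneg : hyperdet (mulAct U₁ᵀ V₁ᵀ W₁ᵀ A₀) < 0 := by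
    rw [hA₀, mulAct_mulAct]
    exact hyperdet_mulAct_neg hdetU hdetV hdetW ha₀
  have hcomp := tendsto_mulAct ((ht.tendsto _).comp hUlim) ((ht.tendsto _).comp hVlim)
    ((ht.tendsto _).comp hWlim) hid
  refine absurd (ge_of_tendsto ((continuous_hyperdet.tendsto _).comp hcomp) ?_) (not_le.2 hneg)
  exact hS.mono fun A hA => hyperdet_nonneg
    (isSumOfOuter_compression (hU A hA) (hV A hA) (hW A hA) (hB A hA) (hAB A hA) (hBfix A hA))

end

end Tensor3

theorem theorem8p4 (d₁ d₂ d₃ : ℕ) (hd₁ : 2 ≤ d₁) (hd₂ : 2 ≤ d₂) (hd₃ : 2 ≤ d₃) :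
    (∃ U : Set (Tensor3 d₁ d₂ d₃), IsOpen U ∧ U.Nonempty ∧
      {A : Tensor3 d₁ d₂ d₃ | Tensor3.IsTypeG₃ A} ⊆ U ∧ U ⊆ Tensor3.noBestApprox d₁ d₂ d₃ 2) ∧
    (Tensor3.noBestApprox d₁ d₂ d₃ 2).Nonempty ∧
    0 < MeasureTheory.volume (Tensor3.noBestApprox d₁ d₂ d₃ 2) := by
  have hsub : {A : Tensor3 d₁ d₂ d₃ | Tensor3.IsTypeG₃ A} ⊆
      interior (Tensor3.noBestApprox d₁ d₂ d₃ 2) := by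
    intro A hA
    obtain ⟨U, hU, V, hV, W, hW, a, ha, rfl⟩ := hA.exists_frames hd₁ hd₂ hd₃
    exact Tensor3.mem_interior_noBestApprox hd₁ hd₂ hd₃ hU hV hW ha
  have hne : (interior (Tensor3.noBestApprox d₁ d₂ d₃ 2)).Nonempty :=
    ⟨_, hsub Tensor3.isTypeG₃_extend_G₃⟩
  exact ⟨⟨_, isOpen_interior, hne, hsub, interior_subset⟩, hne.mono interior_subset,
    (isOpen_interior.measure_pos _ hne).trans_le (MeasureTheory.measure_mono interior_subset)⟩
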